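/- Let $d \ge 1$ be an integer and let $\mathcal D_d$ be the set of states on $\mathbb C^d$, i.e. of positive semidefinite complex $d\times d$ matrices $\rho$ with $\operatorname{Tr}\rho = 1$. For $\rho\in\mathcal D_d$ with eigenvalues $\lambda_1,\dots,\lambda_d$ (counted with multiplicity), let $H(\rho) = -\sum_{i=1}^d \lambda_i\log\lambda_i$ be its von Neumann entropy, with the natural logarithm and $0\log 0 = 0$. Let $g:[0,\infty)\to[0,\infty)$, $g(x) = (x+1)\log(x+1) - x\log x$ (a bijection, with $g(0)=0$). For $c\ge 0$ define the entropy power $E_c(\rho) = e^{cH(\rho)}$ and the entropy photon number $N_c(\rho) = g^{-1}(cH(\rho))$. Then: 1. if $0\le c\le 1/(\log d)^2$, the function $E_c$ is concave on $\mathcal D_d$, i.e. $E_c(a\rho+(1-a)\sigma)\ge a\,E_c(\rho)+(1-a)\,E_c(\sigma)$ for all $\rho,\sigma\in\mathcal D_d$ and $a\in[0,1]$; 2. if $0\le c\le 1/(d-1)$, the function $N_c$ is concave on $\mathcal D_d$. For $d=1$ the two upper bounds on $c$ are read as $+\infty$. -/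

import Mathlib

open scoped ComplexOrder

noncomputable section

/-- The states on `ℂ^d`: positive semidefinite `d × d` complex matrices of trace one. -/
def qState (d : ℕ) : Set (Matrix (Fin d) (Fin d) ℂ) :=
  {ρ | ρ.PosSemidef ∧ ρ.trace = 1}

open Classical in
/-- The von Neumann entropy `-∑ i, λ i * log (λ i)`, where the `λ i` are the eigenvalues of the
Hermitian matrix `ρ` with multiplicity (`Real.negMulLog x = -x * log x`, with value `0` at `0`);
the value `0` off the Hermitian matrices is irrelevant, since states are Hermitian. -/
def vonNeumannEntropy {d : ℕ} (ρ : Matrix (Fin d) (Fin d) ℂ) : ℝ :=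
  if h : ρ.IsHermitian then ∑ i, Real.negMulLog (h.eigenvalues i) else 0

/-- The entropy power `e^{c H(ρ)}`. -/
def entropyPower {d : ℕ} (c : ℝ) (ρ : Matrix (Fin d) (Fin d) ℂ) : ℝ :=
  Real.exp (c * vonNeumannEntropy ρ)

/-- `g(x) = (x + 1) log (x + 1) - x log x`, used for `x ≥ 0`; `g(0) = 0` since `0 * log 0 = 0`. -/
def photonG (x : ℝ) : ℝ :=
  (x + 1) * Real.log (x + 1) - x * Real.log x

/-- `g` maps `[0, ∞)` bijectively onto `[0, ∞)`, so that its inverse is defined there. -/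
theorem photonG_bijOn : Set.BijOn photonG (Set.Ici 0) (Set.Ici 0) := by
  have hc : Continuous photonG := by
    unfold photonG
    exact (Real.continuous_mul_log.comp (continuous_add_const 1)).sub Real.continuous_mul_log
  have h0 : photonG 0 = 0 := by simp [photonG]
  have hm : StrictMonoOn photonG (Set.Ici 0) := by
    refine strictMonoOn_of_deriv_pos (convex_Ici 0) hc.continuousOn fun x hx => ?_
    rw [interior_Ici, Set.mem_Ioi] at hx
    have h2 : HasDerivAt (fun z : ℝ => z * Real.log z) (Real.log (x + 1) + 1) (x + 1) :=
      Real.hasDerivAt_mul_log (by positivity)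
    have h1 : HasDerivAt photonG (Real.log (x + 1) + 1 - (Real.log x + 1)) x :=
      (h2.comp_add_const x 1).sub (Real.hasDerivAt_mul_log hx.ne')
    rw [h1.deriv]
    have := Real.log_lt_log hx (lt_add_one x)
    linarith
  have hle : ∀ x, 0 ≤ x → Real.log (x + 1) ≤ photonG x := fun x hx => by
    unfold photonG
    rcases hx.eq_or_lt with rfl | hx
    · simp
    · have := Real.log_lt_log hx (lt_add_one x)
      nlinarith
  refine ⟨fun x hx => ?_, hm.injOn, fun y hy => ?_⟩
  · have := hm.monotoneOn Set.self_mem_Ici hx hx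
    rwa [h0] at this
  · have hx : (0 : ℝ) ≤ Real.exp y - 1 := by
      have := Real.add_one_le_exp y
      have : (0 : ℝ) ≤ y := hy
      linarith
    have h2 := hle _ hx
    rw [sub_add_cancel, Real.log_exp] at h2
    obtain ⟨x, hx', rfl⟩ := intermediate_value_Icc hx hc.continuousOn ⟨h0.trans_le hy, h2⟩
    exact ⟨x, hx'.1, rfl⟩

/-- The inverse of the bijection `g : [0, ∞) → [0, ∞)`: for `y ≥ 0`, the unique `x ≥ 0` with
`g(x) = y`. -/
def photonGInv : ℝ → ℝ :=
  Function.invFunOn photonG (Set.Ici 0)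

/-- The entropy photon number `g⁻¹(c H(ρ))`. -/
def entropyPhotonNumber {d : ℕ} (c : ℝ) (ρ : Matrix (Fin d) (Fin d) ℂ) : ℝ :=
  photonGInv (c * vonNeumannEntropy ρ)

end

/-!
Measuring two states in the eigenbasis of their mixture can only raise their entropies and keeps
that of the mixture, so it is enough to prove concavity on probability vectors. Along a segment of
probability vectors, Cauchy–Schwarz bounds the square of the derivative of the Shannon entropy `H`
by `-H''` times the variance `V` of `log p`, and so reduces the concavity of `f (c * H)` to
`f'' (c * H) * c * V ≤ f' (c * H)`.

For `f = exp` this is `c * V ≤ 1`, which follows from `V ≤ (log d)²`. With `L = log d`, bounding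
`x * (log x)² + L * (x * log x)` by `3 * L² / (4 * d)` for each entry `x` gives
`∑ p * (log p)² ≤ 3 * L² / 4 + L * H`, and `L * H - H² ≤ L² / 4`. The bound on the entries needs
`3 ≤ d`; for `d = 2`, `V = p * q * (log (p / q))²` with `p + q = 1`, and
`u ≤ log 2 * cosh u` at `u = log (p / q) / 2` gives `V ≤ (log 2)²`.

For `f = g⁻¹` this is `c * V ≤ v (g⁻¹ (c * H))`, where `v x` is the variance of the logarithm of a
geometric distribution of mean `x`. As a function of `g x`, `v x` is concave with nonnegative slopes
and intercepts. Each of its tangents `A + B * g` bounds `V` by `A + B * H` on two-point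
distributions, and summing over all pairs of indices gives `V ≤ A * (d - 1) + B * H` in dimension
`d`.
-/

section DoublyStochastic

open scoped Matrix

variable {n : Type*} [Fintype n] [DecidableEq n] {D : Matrix n n ℝ} {x : n → ℝ}

theorem mulVec_mem_stdSimplex (hD : D ∈ Matrix.colStochastic ℝ n) (hx : x ∈ stdSimplex ℝ n) :
    D *ᵥ x ∈ stdSimplex ℝ n :=
  ⟨Matrix.nonneg_mulVec_of_mem_colStochastic hD hx.1,
    (Matrix.sum_mulVec_of_mem_colStochastic hD).trans hx.2⟩

theorem sum_le_sum_mulVec_of_concaveOn {φ : ℝ → ℝ} {s : Set ℝ} (hφ : ConcaveOn ℝ s φ)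
    (hD : D ∈ doublyStochastic ℝ n) (hx : ∀ k, x k ∈ s) :
    ∑ k, φ (x k) ≤ ∑ i, φ ((D *ᵥ x) i) :=
  calc
    ∑ k, φ (x k) = ∑ k, (∑ i, D i k) * φ (x k) := by
      simp only [sum_col_of_mem_doublyStochastic hD, one_mul]
    _ = ∑ i, ∑ k, D i k * φ (x k) := by
      simp only [Finset.sum_mul]
      exact Finset.sum_comm
    _ ≤ ∑ i, φ ((D *ᵥ x) i) := Finset.sum_le_sum fun i _ =>
      hφ.le_map_sum (fun _ _ => nonneg_of_mem_doublyStochastic hD)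
        (sum_row_of_mem_doublyStochastic hD i) fun k _ => hx k

end DoublyStochastic

section DiagInBasis

open scoped Matrix

variable {𝕜 n : Type*} [RCLike 𝕜] [Fintype n]

/-- The real part of the diagonal of `V* ρ V`. For `V` unitary and `ρ` a quantum state, this is
the distribution of the outcome of measuring `ρ` in the orthonormal basis of the columns of `V`. -/
noncomputable def diagInBasis (V : Matrix n n 𝕜) : Matrix n n 𝕜 →ₗ[ℝ] n → ℝ where
  toFun ρ i := RCLike.re ((star V * ρ * V) i i)
  map_add' ρ σ := by
    ext i
    simp [mul_add, add_mul]
  map_smul' a ρ := by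
    ext i
    simp [RCLike.smul_re]

variable [DecidableEq n]

theorem sum_normSq_row (W : Matrix.unitaryGroup n 𝕜) (i : n) :
    ∑ k, RCLike.normSq (W.1 i k) = 1 := by
  have h : (W.1 * star W.1) i i = 1 := by
    rw [Unitary.mul_star_self_of_mem W.2, Matrix.one_apply_eq]
  simp only [Matrix.mul_apply, Matrix.star_apply, RCLike.star_def, RCLike.mul_conj] at h
  simp only [RCLike.normSq_eq_def']
  exact_mod_cast h

theorem normSq_mem_doublyStochastic (W : Matrix.unitaryGroup n 𝕜) :
    (Matrix.of fun i k => RCLike.normSq (W.1 i k)) ∈ doublyStochastic ℝ n :=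
  mem_doublyStochastic_iff_sum.2 ⟨fun _ _ => RCLike.normSq_nonneg _, sum_normSq_row W,
    fun k => by simpa using sum_normSq_row (star W) k⟩

variable {ρ : Matrix n n 𝕜}

theorem diagInBasis_eigenvectorUnitary (hρ : ρ.IsHermitian) :
    diagInBasis (hρ.eigenvectorUnitary : Matrix n n 𝕜) ρ = hρ.eigenvalues := by
  have h := hρ.conjStarAlgAut_star_eigenvectorUnitary
  rw [Unitary.conjStarAlgAut_star_apply] at h
  ext i
  simp [diagInBasis, h]

theorem exists_doublyStochastic_diagInBasis_eq (hρ : ρ.IsHermitian) (V : Matrix.unitaryGroup n 𝕜) :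
    ∃ D ∈ doublyStochastic ℝ n, diagInBasis (V : Matrix n n 𝕜) ρ = D *ᵥ hρ.eigenvalues := by
  set W := star V * hρ.eigenvectorUnitary with hW
  have hconj : star V.1 * ρ * V.1 =
      W.1 * Matrix.diagonal (RCLike.ofReal ∘ hρ.eigenvalues) * star W.1 := by
    conv_lhs => rw [hρ.spectral_theorem, Unitary.conjStarAlgAut_apply]
    simp [mul_assoc, hW]
  refine ⟨_, normSq_mem_doublyStochastic W, funext fun i => ?_⟩
  calc
    diagInBasis (V : Matrix n n 𝕜) ρ i =
        RCLike.re (∑ k, W.1 i k * hρ.eigenvalues k * star (W.1 i k)) := by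
      change RCLike.re ((star V.1 * ρ * V.1) i i) = _
      rw [hconj, Matrix.mul_apply]
      simp only [Matrix.mul_diagonal, Matrix.star_apply, Function.comp_apply]
    _ = ∑ k, RCLike.normSq (W.1 i k) * hρ.eigenvalues k := by
      rw [map_sum]
      refine Finset.sum_congr rfl fun k _ => ?_
      rw [RCLike.star_def, mul_right_comm, RCLike.mul_conj, RCLike.normSq_eq_def']
      norm_cast

end DiagInBasis

section ShannonEntropy

variable {ι : Type*} [Fintype ι] {p : ι → ℝ}

/-- The Shannon entropy `-∑ i, p i * log (p i)` of a finite distribution, in nats. -/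
noncomputable def shannonEntropy (p : ι → ℝ) : ℝ := ∑ i, Real.negMulLog (p i)

/-- The varentropy (information variance) of a finite distribution `p`: the variance of `log p`
under `p`. -/
noncomputable def varentropy (p : ι → ℝ) : ℝ :=
  ∑ i, p i * Real.log (p i) ^ 2 - shannonEntropy p ^ 2

theorem sum_mul_log_eq_neg_shannonEntropy (p : ι → ℝ) :
    ∑ i, p i * Real.log (p i) = -shannonEntropy p := by
  simp [shannonEntropy, Real.negMulLog]

theorem shannonEntropy_nonneg (hp : p ∈ stdSimplex ℝ ι) : 0 ≤ shannonEntropy p :=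
  Finset.sum_nonneg fun i _ =>
    Real.negMulLog_nonneg (hp.1 i) (mem_Icc_of_mem_stdSimplex hp i).2

theorem continuous_shannonEntropy : Continuous (shannonEntropy : (ι → ℝ) → ℝ) :=
  continuous_finsetSum _ fun i _ => Real.continuous_negMulLog.comp (continuous_apply i)

theorem strictConcaveOn_shannonEntropy :
    StrictConcaveOn ℝ (stdSimplex ℝ ι) shannonEntropy := by
  refine ⟨convex_stdSimplex ℝ ι, fun p hp q hq hpq a b ha hb hab => ?_⟩
  obtain ⟨i, hi⟩ := Function.ne_iff.1 hpq
  simp only [shannonEntropy, Finset.smul_sum, ← Finset.sum_add_distrib]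
  exact Finset.sum_lt_sum
    (fun j _ => Real.concaveOn_negMulLog.2 (hp.1 j) (hq.1 j) ha.le hb.le hab)
    ⟨i, Finset.mem_univ i, Real.strictConcaveOn_negMulLog.2 (hp.1 i) (hq.1 i) hi ha hb hab⟩

theorem varentropy_eq_sum_mul_sq (hp : ∑ i, p i = 1) :
    varentropy p = ∑ i, p i * (Real.log (p i) + shannonEntropy p) ^ 2 := by
  have expand (i : ι) : p i * (Real.log (p i) + shannonEntropy p) ^ 2 =
      p i * Real.log (p i) ^ 2 + 2 * shannonEntropy p * (p i * Real.log (p i)) +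
        p i * shannonEntropy p ^ 2 := by ring
  simp only [expand, Finset.sum_add_distrib, ← Finset.mul_sum, ← Finset.sum_mul, hp,
    sum_mul_log_eq_neg_shannonEntropy, varentropy]
  ring

theorem two_mul_varentropy_eq (hp : ∑ i, p i = 1) :
    2 * varentropy p = ∑ i, ∑ j, p i * p j * (Real.log (p i) - Real.log (p j)) ^ 2 := by
  have expand (i j : ι) : p i * p j * (Real.log (p i) - Real.log (p j)) ^ 2 =
      p i * Real.log (p i) ^ 2 * p j + p i * (p j * Real.log (p j) ^ 2) -
        2 * (p i * Real.log (p i)) * (p j * Real.log (p j)) := by ring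
  simp only [expand, Finset.sum_sub_distrib, Finset.sum_add_distrib, ← Finset.mul_sum,
    ← Finset.sum_mul, hp, sum_mul_log_eq_neg_shannonEntropy, varentropy]
  ring

theorem sq_sum_mul_log_le {δ : ι → ℝ} (hp : p ∈ stdSimplex ℝ ι) (hδ : ∑ i, δ i = 0)
    (hδ0 : ∀ i, p i = 0 → δ i = 0) :
    (∑ i, δ i * Real.log (p i)) ^ 2 ≤ (∑ i, δ i ^ 2 / p i) * varentropy p := by
  have hcenter : ∑ i, δ i * Real.log (p i) =
      ∑ i, δ i * (Real.log (p i) + shannonEntropy p) := by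
    simp only [mul_add, Finset.sum_add_distrib, ← Finset.sum_mul, hδ, zero_mul, add_zero]
  rw [hcenter, varentropy_eq_sum_mul_sq hp.2]
  refine Finset.sum_sq_le_sum_mul_sum_of_sq_le_mul _
    (fun i _ => div_nonneg (sq_nonneg _) (hp.1 i))
    (fun i _ => mul_nonneg (hp.1 i) (sq_nonneg _)) fun i _ => le_of_eq ?_
  rcases eq_or_ne (p i) 0 with hi | hi
  · simp [hδ0 i hi]
  · field_simp

end ShannonEntropy

section States

variable {d : ℕ} {ρ : Matrix (Fin d) (Fin d) ℂ}

theorem vonNeumannEntropy_eq (hρ : ρ.IsHermitian) :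
    vonNeumannEntropy ρ = shannonEntropy hρ.eigenvalues := by
  simp [vonNeumannEntropy, shannonEntropy, hρ]

theorem convex_qState (d : ℕ) : Convex ℝ (qState d) := by
  rintro ρ ⟨hρ, hρ1⟩ σ ⟨hσ, hσ1⟩ a b ha hb hab
  refine ⟨(hρ.smul ha).add (hσ.smul hb), ?_⟩
  rw [Matrix.trace_add, Matrix.trace_smul, Matrix.trace_smul, hρ1, hσ1, ← add_smul, hab, one_smul]

theorem eigenvalues_mem_stdSimplex (hρ : ρ ∈ qState d) :
    hρ.1.1.eigenvalues ∈ stdSimplex ℝ (Fin d) := by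
  refine ⟨hρ.1.eigenvalues_nonneg, ?_⟩
  have h := hρ.1.1.trace_eq_sum_eigenvalues.symm.trans hρ.2
  simpa using congrArg Complex.re h

theorem vonNeumannEntropy_nonneg (hρ : ρ ∈ qState d) : 0 ≤ vonNeumannEntropy ρ :=
  vonNeumannEntropy_eq hρ.1.1 ▸ shannonEntropy_nonneg (eigenvalues_mem_stdSimplex hρ)

theorem diagInBasis_mem_stdSimplex (hρ : ρ ∈ qState d) (V : Matrix.unitaryGroup (Fin d) ℂ) :
    diagInBasis (V : Matrix (Fin d) (Fin d) ℂ) ρ ∈ stdSimplex ℝ (Fin d) := by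
  obtain ⟨D, hD, h⟩ := exists_doublyStochastic_diagInBasis_eq hρ.1.1 V
  rw [h]
  exact mulVec_mem_stdSimplex (mem_doublyStochastic_iff_mem_rowStochastic_and_mem_colStochastic.1
    hD).2 (eigenvalues_mem_stdSimplex hρ)

theorem vonNeumannEntropy_le_shannonEntropy_diagInBasis (hρ : ρ ∈ qState d)
    (V : Matrix.unitaryGroup (Fin d) ℂ) :
    vonNeumannEntropy ρ ≤ shannonEntropy (diagInBasis (V : Matrix (Fin d) (Fin d) ℂ) ρ) := by
  obtain ⟨D, hD, h⟩ := exists_doublyStochastic_diagInBasis_eq hρ.1.1 V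
  rw [h, vonNeumannEntropy_eq hρ.1.1]
  exact sum_le_sum_mulVec_of_concaveOn Real.concaveOn_negMulLog hD
    (eigenvalues_mem_stdSimplex hρ).1

theorem concaveOn_comp_vonNeumannEntropy {f : ℝ → ℝ} (hf : MonotoneOn f (Set.Ici 0))
    (hc : ConcaveOn ℝ (stdSimplex ℝ (Fin d)) fun p => f (shannonEntropy p)) :
    ConcaveOn ℝ (qState d) fun ρ => f (vonNeumannEntropy ρ) := by
  refine ⟨convex_qState d, fun ρ hρ σ hσ a b ha hb hab => ?_⟩
  have hτ := convex_qState d hρ hσ ha hb hab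
  set V := hτ.1.1.eigenvectorUnitary
  have le_dephased ⦃μ⦄ (hμ : μ ∈ qState d) : f (vonNeumannEntropy μ) ≤
      f (shannonEntropy (diagInBasis (V : Matrix (Fin d) (Fin d) ℂ) μ)) := by
    have h := vonNeumannEntropy_le_shannonEntropy_diagInBasis hμ V
    have h0 := vonNeumannEntropy_nonneg hμ
    exact hf h0 (h0.trans h) h
  calc
    a • f (vonNeumannEntropy ρ) + b • f (vonNeumannEntropy σ) ≤
        a • f (shannonEntropy (diagInBasis V.1 ρ)) + b • f (shannonEntropy (diagInBasis V.1 σ)) :=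
      add_le_add (smul_le_smul_of_nonneg_left (le_dephased hρ) ha)
        (smul_le_smul_of_nonneg_left (le_dephased hσ) hb)
    _ ≤ f (shannonEntropy (a • diagInBasis V.1 ρ + b • diagInBasis V.1 σ)) :=
      hc.2 (diagInBasis_mem_stdSimplex hρ V) (diagInBasis_mem_stdSimplex hσ V) ha hb hab
    _ = f (vonNeumannEntropy (a • ρ + b • σ)) := by
      rw [← map_smul, ← map_smul, ← map_add, diagInBasis_eigenvectorUnitary,
        vonNeumannEntropy_eq hτ.1.1]

end States

section SecondOrderCriterion

open AffineMap (lineMap)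

theorem concaveOn_of_lineMap {E : Type*} [AddCommGroup E] [Module ℝ E] {s : Set E} {f : E → ℝ}
    (hs : Convex ℝ s)
    (hf : ∀ x ∈ s, ∀ y ∈ s, x ≠ y →
      ConcaveOn ℝ (Set.Icc 0 1) fun t : ℝ => f (lineMap x y t)) :
    ConcaveOn ℝ s f := by
  refine ⟨hs, fun x hx y hy a b ha hb hab => ?_⟩
  rcases eq_or_ne x y with rfl | hxy
  · rw [← add_smul, ← add_smul, hab, one_smul, one_smul]
  · have h := (hf x hx y hy hxy).2 (Set.left_mem_Icc.2 zero_le_one)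
      (Set.right_mem_Icc.2 zero_le_one) ha hb hab
    have hline : lineMap x y (a • (0 : ℝ) + b • 1) = a • x + b • y := by
      simp [AffineMap.lineMap_apply_module, eq_sub_of_add_eq hab]
    simpa only [AffineMap.lineMap_apply_zero, AffineMap.lineMap_apply_one, hline] using h

theorem eq_of_lineMap_eq_zero {x y t : ℝ} (hx : 0 ≤ x) (hy : 0 ≤ y) (ht : t ∈ Set.Ioo 0 1)
    (h : lineMap x y t = 0) : x = y := by
  have hxt := mul_nonneg (sub_nonneg.2 ht.2.le) hx
  have hyt := mul_nonneg ht.1.le hy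
  rw [AffineMap.lineMap_apply_ring] at h
  have hx0 : x = 0 := (mul_eq_zero.1 (by linarith : (1 - t) * x = 0)).resolve_left
    (sub_pos.2 ht.2).ne'
  have hy0 : y = 0 := (mul_eq_zero.1 (by linarith : t * y = 0)).resolve_left ht.1.ne'
  rw [hx0, hy0]

theorem concaveOn_comp_of_hasDerivAt2 {s : Set ℝ} (hs : Convex ℝ s)
    {f f' f'' h h' h'' : ℝ → ℝ} (hcont : ContinuousOn (fun t => f (h t)) s)
    (hf : ∀ t ∈ interior s, HasDerivAt f (f' (h t)) (h t))
    (hf' : ∀ t ∈ interior s, HasDerivAt f' (f'' (h t)) (h t))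
    (hh : ∀ t ∈ interior s, HasDerivAt h (h' t) t)
    (hh' : ∀ t ∈ interior s, HasDerivAt h' (h'' t) t)
    (hnonpos : ∀ t ∈ interior s, f'' (h t) * h' t ^ 2 + f' (h t) * h'' t ≤ 0) :
    ConcaveOn ℝ s fun t => f (h t) := by
  refine concaveOn_of_hasDerivWithinAt2_nonpos hs hcont
    (fun t ht => ((hf t ht).comp t (hh t ht)).hasDerivWithinAt)
    (fun t ht => (((hf' t ht).comp t (hh t ht)).mul (hh' t ht)).hasDerivWithinAt)
    fun t ht => ?_
  simpa only [Function.comp_apply, mul_assoc, ← sq] using hnonpos t ht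

variable {ι : Type*} [Fintype ι] {p q : ι → ℝ} {t : ℝ}

theorem hasDerivAt_shannonEntropy_lineMap (hpq : ∑ i, (q i - p i) = 0)
    (h0 : ∀ i, lineMap p q t i = 0 → p i = q i) :
    HasDerivAt (fun s => shannonEntropy (lineMap p q s))
      (-∑ i, (q i - p i) * Real.log (lineMap p q t i)) t := by
  have h : HasDerivAt (fun s => shannonEntropy (lineMap p q s))
      (∑ i, -((q i - p i) * Real.log (lineMap p q t i) + (q i - p i))) t := by
    refine HasDerivAt.fun_sum fun i _ => ?_
    simp only [AffineMap.pi_lineMap_apply] at h0 ⊢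
    rcases eq_or_ne (lineMap (p i) (q i) t) 0 with hi | hi
    · simpa [h0 i hi] using hasDerivAt_const t (Real.negMulLog (q i))
    · exact ((Real.hasDerivAt_negMulLog hi).comp t AffineMap.hasDerivAt_lineMap).congr_deriv
        (by ring)
  refine h.congr_deriv ?_
  rw [Finset.sum_neg_distrib, Finset.sum_add_distrib, hpq, add_zero]

theorem hasDerivAt_neg_sum_mul_log_lineMap (h0 : ∀ i, lineMap p q t i = 0 → p i = q i) :
    HasDerivAt (fun s => -∑ i, (q i - p i) * Real.log (lineMap p q s i))
      (-∑ i, (q i - p i) ^ 2 / lineMap p q t i) t := by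
  refine HasDerivAt.neg (HasDerivAt.fun_sum fun i _ => ?_)
  simp only [AffineMap.pi_lineMap_apply] at h0 ⊢
  rcases eq_or_ne (lineMap (p i) (q i) t) 0 with hi | hi
  · simpa [h0 i hi] using hasDerivAt_const t (0 : ℝ)
  · exact ((AffineMap.hasDerivAt_lineMap.log hi).const_mul (q i - p i)).congr_deriv (by ring)

theorem shannonEntropy_lineMap_pos (hp : p ∈ stdSimplex ℝ ι) (hq : q ∈ stdSimplex ℝ ι)
    (hpq : p ≠ q) (ht : t ∈ Set.Ioo 0 1) : 0 < shannonEntropy (lineMap p q t) := by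
  have h := strictConcaveOn_shannonEntropy.2 hp hq hpq (sub_pos.2 ht.2) ht.1 (sub_add_cancel 1 t)
  rw [AffineMap.lineMap_apply_module]
  exact h.trans_le' (add_nonneg (mul_nonneg (sub_pos.2 ht.2).le (shannonEntropy_nonneg hp))
    (mul_nonneg ht.1.le (shannonEntropy_nonneg hq)))

theorem mul_sq_le_mul_of_sq_le_mul {a b s v x : ℝ} (hx : x ^ 2 ≤ s * v) (hab : a * v ≤ b)
    (hs : 0 ≤ s) (hb : 0 ≤ b) : a * x ^ 2 ≤ b * s := by
  rcases le_total a 0 with ha | ha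
  · exact (mul_nonpos_of_nonpos_of_nonneg ha (sq_nonneg x)).trans (mul_nonneg hb hs)
  · calc
      a * x ^ 2 ≤ a * (s * v) := mul_le_mul_of_nonneg_left hx ha
      _ = a * v * s := by ring
      _ ≤ b * s := mul_le_mul_of_nonneg_right hab hs

theorem concaveOn_comp_shannonEntropy {f f' f'' : ℝ → ℝ}
    (hf : ContinuousOn f (Set.Ici 0)) (hf' : ∀ y, 0 < y → HasDerivAt f (f' y) y)
    (hf'' : ∀ y, 0 < y → HasDerivAt f' (f'' y) y) (hpos : ∀ y, 0 < y → 0 ≤ f' y)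
    (hvar : ∀ p ∈ stdSimplex ℝ ι, 0 < shannonEntropy p →
      f'' (shannonEntropy p) * varentropy p ≤ f' (shannonEntropy p)) :
    ConcaveOn ℝ (stdSimplex ℝ ι) fun p => f (shannonEntropy p) := by
  refine concaveOn_of_lineMap (convex_stdSimplex ℝ ι) fun p hp q hq hpq => ?_
  have hmem {t : ℝ} (ht : t ∈ Set.Icc (0 : ℝ) 1) : lineMap p q t ∈ stdSimplex ℝ ι :=
    (convex_stdSimplex ℝ ι).lineMap_mem hp hq ht
  have hδ : ∑ i, (q i - p i) = 0 := by rw [Finset.sum_sub_distrib, hq.2, hp.2, sub_self]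
  have h0 {t : ℝ} (ht : t ∈ Set.Ioo (0 : ℝ) 1) (i : ι) (hi : lineMap p q t i = 0) : p i = q i :=
    eq_of_lineMap_eq_zero (hp.1 i) (hq.1 i) ht (by rwa [AffineMap.pi_lineMap_apply] at hi)
  have hH {t : ℝ} (ht : t ∈ Set.Ioo (0 : ℝ) 1) := shannonEntropy_lineMap_pos hp hq hpq ht
  have hcont : ContinuousOn (fun t : ℝ => f (shannonEntropy (lineMap p q t))) (Set.Icc 0 1) :=
    hf.comp (continuous_shannonEntropy.comp AffineMap.lineMap_continuous).continuousOn
      fun t ht => shannonEntropy_nonneg (hmem ht)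
  refine concaveOn_comp_of_hasDerivAt2 (convex_Icc 0 1) hcont
    (fun t ht => hf' _ (hH (interior_Icc.subset ht)))
    (fun t ht => hf'' _ (hH (interior_Icc.subset ht)))
    (fun t ht => hasDerivAt_shannonEntropy_lineMap hδ (h0 (interior_Icc.subset ht)))
    (fun t ht => hasDerivAt_neg_sum_mul_log_lineMap (h0 (interior_Icc.subset ht)))
    fun t ht => ?_
  rw [interior_Icc] at ht
  have hx := hmem (Set.Ioo_subset_Icc_self ht)
  have hcs := sq_sum_mul_log_le hx hδ fun i hi => sub_eq_zero.2 (h0 ht i hi).symm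
  have hS : 0 ≤ ∑ i, (q i - p i) ^ 2 / lineMap p q t i :=
    Finset.sum_nonneg fun i _ => div_nonneg (sq_nonneg _) (hx.1 i)
  rw [neg_sq, mul_neg, ← sub_eq_add_neg, sub_nonpos]
  exact mul_sq_le_mul_of_sq_le_mul hcs (hvar _ hx (hH ht)) hS (hpos _ (hH ht))

theorem concaveOn_comp_mul_shannonEntropy {c : ℝ} (hc : 0 ≤ c) {f f' f'' : ℝ → ℝ}
    (hf : ContinuousOn f (Set.Ici 0)) (hf' : ∀ y, 0 < y → HasDerivAt f (f' y) y)
    (hf'' : ∀ y, 0 < y → HasDerivAt f' (f'' y) y) (hpos : ∀ y, 0 < y → 0 ≤ f' y)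
    (hvar : ∀ p ∈ stdSimplex ℝ ι, 0 < c * shannonEntropy p →
      f'' (c * shannonEntropy p) * (c * varentropy p) ≤ f' (c * shannonEntropy p)) :
    ConcaveOn ℝ (stdSimplex ℝ ι) fun p => f (c * shannonEntropy p) := by
  rcases hc.eq_or_lt with rfl | hc
  · simpa only [zero_mul] using concaveOn_const (f 0) (convex_stdSimplex ℝ ι)
  have hmul (y : ℝ) : HasDerivAt (fun y => c * y) c y := hasDerivAt_const_mul c
  refine concaveOn_comp_shannonEntropy (f := fun y => f (c * y))
    (hf.comp (by fun_prop) fun y hy => mul_nonneg hc.le hy)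
    (fun y hy => (hf' _ (mul_pos hc hy)).comp y (hmul y))
    (fun y hy => ((hf'' _ (mul_pos hc hy)).comp y (hmul y)).mul_const c)
    (fun y hy => mul_nonneg (hpos _ (mul_pos hc hy)) hc.le) fun p hp hH => ?_
  calc
    f'' (c * shannonEntropy p) * c * c * varentropy p =
        f'' (c * shannonEntropy p) * (c * varentropy p) * c := by ring
    _ ≤ f' (c * shannonEntropy p) * c :=
      mul_le_mul_of_nonneg_right (hvar p hp (mul_pos hc hH)) hc.le

end SecondOrderCriterion

section BinaryBound

open Real

-- The factor `y / (1 - x)` makes these bounds summable: for a fixed entry `x` of a probability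
-- vector, it adds up to `1` over the other entries `y`.
theorem add_mul_log_sub_log_le {x y : ℝ} (hx : 0 ≤ x) (hy : 0 ≤ y) (hxy : x + y ≤ 1) :
    (x + y) * (x * (log (x + y) - log x)) ≤ y / (1 - x) * negMulLog x := by
  rcases hy.eq_or_lt with rfl | hy
  · simp
  have hx1 : 0 < 1 - x := by linarith
  set θ := y / (1 - x)
  have hθy : θ * (1 - x) = y := div_mul_cancel₀ _ hx1.ne'
  have hθ1 : θ ≤ 1 := (div_le_one hx1).2 (by linarith)
  have hxy_eq : x + y = (1 - θ) * x + θ := by rw [← hθy]; ring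
  have hconv : (x + y) * log (x + y) ≤ (1 - θ) * (x * log x) := by
    have h := convexOn_mul_log.2 (x := x) hx (y := 1) (zero_le_one' ℝ) (sub_nonneg.2 hθ1)
      (by positivity) (sub_add_cancel 1 θ)
    simpa [hxy_eq] using h
  calc
    (x + y) * (x * (log (x + y) - log x)) =
        x * ((x + y) * log (x + y) - ((1 - θ) * x + θ) * log x) := by rw [← hxy_eq]; ring
    _ ≤ x * ((1 - θ) * (x * log x) - ((1 - θ) * x + θ) * log x) := by gcongr
    _ = θ * negMulLog x := by rw [negMulLog]; ring

variable {A B : ℝ}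

theorem mul_mul_log_sub_log_sq_le_of_binary
    (h : ∀ p ∈ Set.Ioo (0 : ℝ) 1, p * (1 - p) * (log p - log (1 - p)) ^ 2 ≤ A + B * binEntropy p)
    {x y : ℝ} (hx : 0 < x) (hy : 0 < y) :
    x * y * (log x - log y) ^ 2 ≤ A * (x + y) ^ 2 +
      B * ((x + y) * (x * (log (x + y) - log x)) + (y + x) * (y * (log (y + x) - log y))) := by
  have hs : 0 < x + y := add_pos hx hy
  have hq : 1 - x / (x + y) = y / (x + y) := by field_simp; ring
  have hp := h (x / (x + y)) ⟨div_pos hx hs, (div_lt_one hs).2 (by linarith)⟩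
  rw [binEntropy_eq_negMulLog_add_negMulLog_one_sub, hq, negMulLog, negMulLog,
    log_div hx.ne' hs.ne', log_div hy.ne' hs.ne'] at hp
  calc
    x * y * (log x - log y) ^ 2 = (x + y) ^ 2 * (x / (x + y) * (y / (x + y)) *
        (log x - log (x + y) - (log y - log (x + y))) ^ 2) := by field_simp; ring
    _ ≤ (x + y) ^ 2 * _ := mul_le_mul_of_nonneg_left hp (sq_nonneg _)
    _ = _ := by rw [add_comm y x]; field_simp; ring

theorem mul_mul_log_sub_log_sq_le_add (hA : 0 ≤ A) (hB : 0 ≤ B)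
    (h : ∀ p ∈ Set.Ioo (0 : ℝ) 1, p * (1 - p) * (log p - log (1 - p)) ^ 2 ≤ A + B * binEntropy p)
    {x y : ℝ} (hx : 0 ≤ x) (hy : 0 ≤ y) (hxy : x + y ≤ 1) :
    x * y * (log x - log y) ^ 2 ≤
      (A * x + B * (y / (1 - x) * negMulLog x)) + (A * y + B * (x / (1 - y) * negMulLog y)) := by
  have hyx : y + x ≤ 1 := by linarith
  suffices x * y * (log x - log y) ^ 2 ≤ A * (x + y) +
      B * (y / (1 - x) * negMulLog x + x / (1 - y) * negMulLog y) by linarith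
  have hx' := negMulLog_nonneg hx (by linarith)
  have hy' := negMulLog_nonneg hy (by linarith)
  have hx1 : 0 ≤ 1 - x := by linarith
  have hy1 : 0 ≤ 1 - y := by linarith
  rcases hx.eq_or_lt with rfl | hx0
  · simp only [zero_mul, zero_add, sub_zero, div_one, zero_div, negMulLog_zero, mul_zero, add_zero]
    positivity
  rcases hy.eq_or_lt with rfl | hy0
  · simp only [zero_mul, sub_zero, div_one, zero_div, negMulLog_zero, mul_zero, add_zero]
    positivity
  refine (mul_mul_log_sub_log_sq_le_of_binary h hx0 hy0).trans ?_
  have hsq : (x + y) ^ 2 ≤ x + y := pow_le_of_le_one (add_nonneg hx hy) hxy two_ne_zero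
  exact add_le_add (mul_le_mul_of_nonneg_left hsq hA) (mul_le_mul_of_nonneg_left
    (add_le_add (add_mul_log_sub_log_le hx hy hxy) (add_mul_log_sub_log_le hy hx hyx)) hB)

theorem sum_sum_le_two_nsmul_sum {ι M : Type*} [Fintype ι] [DecidableEq ι] [AddCommMonoid M]
    [PartialOrder M] [IsOrderedAddMonoid M] {t r : ι → ι → M} {R : ι → M} (ht0 : ∀ i, t i i = 0)
    (ht : ∀ i j, i ≠ j → t i j ≤ r i j + r j i)
    (hR : ∀ i, ∑ j ∈ Finset.univ.erase i, r i j ≤ R i) :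
    ∑ i, ∑ j, t i j ≤ 2 • ∑ i, R i :=
  have hswap : ∑ i, ∑ j ∈ Finset.univ.erase i, r j i = ∑ i, ∑ j ∈ Finset.univ.erase i, r i j :=
    Finset.sum_comm' fun i j => by simp [ne_comm]
  calc
    ∑ i, ∑ j, t i j = ∑ i, ∑ j ∈ Finset.univ.erase i, t i j :=
      Finset.sum_congr rfl fun i _ => (Finset.sum_erase _ (ht0 i)).symm
    _ ≤ ∑ i, ∑ j ∈ Finset.univ.erase i, (r i j + r j i) := Finset.sum_le_sum fun i _ =>
      Finset.sum_le_sum fun j hj => ht i j (Finset.ne_of_mem_erase hj).symm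
    _ = 2 • ∑ i, ∑ j ∈ Finset.univ.erase i, r i j := by
      simp only [Finset.sum_add_distrib, hswap, two_nsmul]
    _ ≤ 2 • ∑ i, R i := nsmul_le_nsmul_right (Finset.sum_le_sum fun i _ => hR i) 2

variable {ι : Type*} [Fintype ι] {p : ι → ℝ}

theorem sum_erase_div_mul_le [DecidableEq ι] (hp : ∑ i, p i = 1) (i : ι) {m : ℝ} (hm : 0 ≤ m) :
    ∑ j ∈ Finset.univ.erase i, p j / (1 - p i) * m ≤ m := by
  rw [← Finset.sum_mul, ← Finset.sum_div, Finset.sum_erase_eq_sub (Finset.mem_univ i), hp]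
  exact mul_le_of_le_one_left hm (div_self_le_one _)

theorem varentropy_le_of_binary (hA : 0 ≤ A) (hB : 0 ≤ B)
    (h : ∀ x ∈ Set.Ioo (0 : ℝ) 1, x * (1 - x) * (log x - log (1 - x)) ^ 2 ≤ A + B * binEntropy x)
    (hp : p ∈ stdSimplex ℝ ι) :
    varentropy p ≤ A * (Fintype.card ι - 1) + B * shannonEntropy p := by
  classical
  have hpair (i j : ι) (hij : i ≠ j) : p i * p j * (log (p i) - log (p j)) ^ 2 ≤
      (A * p i + B * (p j / (1 - p i) * negMulLog (p i))) +
        (A * p j + B * (p i / (1 - p j) * negMulLog (p j))) := by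
    refine mul_mul_log_sub_log_sq_le_add hA hB h (hp.1 i) (hp.1 j) ?_
    rw [← hp.2, ← Finset.sum_pair hij]
    exact Finset.sum_le_sum_of_subset_of_nonneg (Finset.subset_univ _) fun k _ _ => hp.1 k
  have hrow (i : ι) : ∑ j ∈ Finset.univ.erase i,
      (A * p i + B * (p j / (1 - p i) * negMulLog (p i))) ≤
        A * (Fintype.card ι - 1) * p i + B * negMulLog (p i) := by
    have hm : 0 ≤ negMulLog (p i) :=
      negMulLog_nonneg (hp.1 i) (mem_Icc_of_mem_stdSimplex hp i).2
    rw [Finset.sum_add_distrib, Finset.sum_const, ← Finset.mul_sum, nsmul_eq_mul,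
      Finset.cast_card_erase_of_mem (Finset.mem_univ i), Finset.card_univ]
    have hle := mul_le_mul_of_nonneg_left (sum_erase_div_mul_le hp.2 i hm) hB
    linarith
  have hsum := sum_sum_le_two_nsmul_sum (fun i => by simp) hpair hrow
  rw [← two_mul_varentropy_eq hp.2, Finset.sum_add_distrib, ← Finset.mul_sum, ← Finset.mul_sum,
    hp.2, nsmul_eq_mul] at hsum
  rw [shannonEntropy]
  push_cast at hsum
  linarith

end BinaryBound

section LogCardBound

open Real

theorem le_log_two_mul_cosh (u : ℝ) : u ≤ log 2 * cosh u := by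
  -- The two sides are closest near `u = 1.2`, so the tangent of `exp` at `log 3` is sharp enough.
  have htangent : u - log 3 + 1 ≤ exp u / 3 := by
    simpa [exp_sub, exp_log] using add_one_le_exp (u - log 3)
  have hlog3 := log_three_lt_d9
  have hquad : u * exp u ≤ 0.69314 * ((exp u ^ 2 + 1) / 2) := by
    nlinarith [exp_pos u, sq_nonneg (exp u - 3.7)]
  have hcosh : 0.69314 * ((exp u ^ 2 + 1) / 2) ≤ log 2 * cosh u * exp u := by
    have h : cosh u * exp u = (exp u ^ 2 + 1) / 2 := by
      rw [cosh_eq, exp_neg]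
      field_simp
    rw [mul_assoc, h]
    have := log_two_gt_d9
    gcongr
    linarith
  exact le_of_mul_le_mul_right (hquad.trans hcosh) (exp_pos u)

theorem sq_le_log_two_sq_mul_cosh_sq (u : ℝ) : u ^ 2 ≤ log 2 ^ 2 * cosh u ^ 2 := by
  rw [← mul_pow, ← sq_abs, ← cosh_abs]
  exact pow_le_pow_left₀ (abs_nonneg u) (le_log_two_mul_cosh |u|) 2

theorem mul_one_sub_mul_log_sub_log_sq_le {p : ℝ} (hp : p ∈ Set.Ioo (0 : ℝ) 1) :
    p * (1 - p) * (log p - log (1 - p)) ^ 2 ≤ log 2 ^ 2 := by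
  have hq : 0 < 1 - p := sub_pos.2 hp.2
  set u := (log p - log (1 - p)) / 2 with hu
  have hcosh : 4 * (p * (1 - p)) * cosh u ^ 2 = 1 := by
    have h : cosh (2 * u) = (p / (1 - p) + (p / (1 - p))⁻¹) / 2 := by
      rw [← cosh_log (div_pos hp.1 hq), log_div hp.1.ne' hq.ne', hu]
      ring_nf
    have hdouble : cosh u ^ 2 = (cosh (2 * u) + 1) / 2 := by
      rw [cosh_two_mul, sinh_sq]
      ring
    rw [hdouble, h]
    have := hp.1.ne'
    field_simp
    ring
  calc
    p * (1 - p) * (log p - log (1 - p)) ^ 2 = 4 * (p * (1 - p)) * u ^ 2 := by rw [hu]; ring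
    _ ≤ 4 * (p * (1 - p)) * (log 2 ^ 2 * cosh u ^ 2) :=
      mul_le_mul_of_nonneg_left (sq_le_log_two_sq_mul_cosh_sq u)
        (mul_nonneg zero_le_four (mul_pos hp.1 hq).le)
    _ = log 2 ^ 2 * (4 * (p * (1 - p)) * cosh u ^ 2) := by ring
    _ = log 2 ^ 2 := by rw [hcosh, mul_one]

theorem one_add_two_mul_sq_le_exp {v : ℝ} (hv : 0 ≤ v) : 0.28 * (1 + 2 * v) ^ 2 ≤ exp v := by
  have hlin : (1 + 2 * v) / 4 ≤ exp ((v - 3 / 2) / 2) := by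
    linarith [add_one_le_exp ((v - 3 / 2) / 2)]
  have hexp : 4.48 ≤ exp (3 / 2) := by
    refine le_of_sq_le_sq ?_ (exp_pos _).le
    calc
      (4.48 : ℝ) ^ 2 ≤ 2.7182818283 ^ 3 := by norm_num
      _ ≤ exp 1 ^ 3 := by gcongr; exact exp_one_gt_d9.le
      _ = exp (3 / 2) ^ 2 := by rw [← exp_nat_mul, ← exp_nat_mul]; norm_num
  calc
    0.28 * (1 + 2 * v) ^ 2 = 4.48 * ((1 + 2 * v) / 4) ^ 2 := by ring
    _ ≤ exp (3 / 2) * exp ((v - 3 / 2) / 2) ^ 2 := by gcongr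
    _ = exp v := by
      rw [← exp_nat_mul, ← exp_add]
      push_cast
      ring_nf

theorem mul_add_le_sq_mul_exp {v L : ℝ} (hL : log 3 ≤ L) (hv : -L ≤ v) :
    v * (v + L) ≤ 3 / 4 * L ^ 2 * exp v := by
  rcases le_total v 0 with hv0 | hv0
  · exact (mul_nonpos_of_nonpos_of_nonneg hv0 (by linarith)).trans (by positivity)
  · have hL' : 1.0986 ≤ L := by linarith [log_three_gt_d9]
    calc
      v * (v + L) ≤ 3 / 4 * L ^ 2 * (0.28 * (1 + 2 * v) ^ 2) := by
        have hquad : 0.0138 ≤ 0.84 * L ^ 2 - 1 := by nlinarith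
        have hlin : -0.085 ≤ 0.84 * L ^ 2 - L := by nlinarith
        have hconst : 0.25 ≤ 0.21 * L ^ 2 := by nlinarith
        nlinarith [mul_le_mul_of_nonneg_right hquad (sq_nonneg v),
          mul_le_mul_of_nonneg_right hlin hv0, hconst, sq_nonneg (v - 3)]
      _ ≤ 3 / 4 * L ^ 2 * exp v := by
        gcongr
        exact one_add_two_mul_sq_le_exp hv0

theorem mul_log_sq_add_log_mul_le {x d : ℝ} (hx : x ∈ Set.Icc (0 : ℝ) 1) (hd : 3 ≤ d) :
    x * log x ^ 2 + log d * (x * log x) ≤ 3 / 4 * log d ^ 2 / d := by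
  rcases hx.1.eq_or_lt with rfl | hx0
  · simp only [log_zero, zero_mul, mul_zero, add_zero]
    positivity
  have hd0 : 0 < d := by linarith
  have h := mul_add_le_sq_mul_exp (v := -log x - log d) (log_le_log three_pos hd)
    (by linarith [log_nonpos hx.1 hx.2])
  have hexp : x * exp (-log x - log d) = 1 / d := by
    rw [exp_sub, exp_neg, exp_log hx0, exp_log hd0]
    field_simp
  calc
    x * log x ^ 2 + log d * (x * log x) =
        x * ((-log x - log d) * (-log x - log d + log d)) := by ring
    _ ≤ x * (3 / 4 * log d ^ 2 * exp (-log x - log d)) := mul_le_mul_of_nonneg_left h hx.1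
    _ = 3 / 4 * log d ^ 2 * (x * exp (-log x - log d)) := by ring
    _ = 3 / 4 * log d ^ 2 / d := by rw [hexp, mul_one_div]

variable {ι : Type*} [Fintype ι] {p : ι → ℝ}

theorem varentropy_le_log_two_sq_mul (hp : p ∈ stdSimplex ℝ ι) :
    varentropy p ≤ log 2 ^ 2 * (Fintype.card ι - 1) := by
  simpa using varentropy_le_of_binary (sq_nonneg (log 2)) le_rfl
    (fun x hx => by simpa using mul_one_sub_mul_log_sub_log_sq_le hx) hp

theorem varentropy_le_log_card_sq_of_three_le (hι : 3 ≤ Fintype.card ι)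
    (hp : p ∈ stdSimplex ℝ ι) : varentropy p ≤ log (Fintype.card ι) ^ 2 := by
  obtain ⟨d, hd⟩ : ∃ d : ℝ, d = Fintype.card ι := ⟨_, rfl⟩
  have hd3 : 3 ≤ d := by rw [hd]; exact_mod_cast hι
  rw [← hd]
  have hsum : ∑ i, p i * log (p i) ^ 2 - log d * shannonEntropy p ≤ 3 / 4 * log d ^ 2 := by
    calc
      ∑ i, p i * log (p i) ^ 2 - log d * shannonEntropy p =
          ∑ i, (p i * log (p i) ^ 2 + log d * (p i * log (p i))) := by
        rw [Finset.sum_add_distrib, ← Finset.mul_sum, sum_mul_log_eq_neg_shannonEntropy]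
        ring
      _ ≤ ∑ _i : ι, 3 / 4 * log d ^ 2 / d := Finset.sum_le_sum fun i _ =>
        mul_log_sq_add_log_mul_le (mem_Icc_of_mem_stdSimplex hp i) hd3
      _ = 3 / 4 * log d ^ 2 := by
        rw [Finset.sum_const, Finset.card_univ, nsmul_eq_mul, ← hd]
        field_simp
  rw [varentropy]
  linarith [sq_nonneg (shannonEntropy p - log d / 2)]

theorem varentropy_le_log_card_sq (hp : p ∈ stdSimplex ℝ ι) :
    varentropy p ≤ log (Fintype.card ι) ^ 2 := by
  have hne : Nonempty ι := by
    by_contra h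
    simpa [not_nonempty_iff.1 h] using hp.2
  have hpos := Fintype.card_pos (α := ι)
  obtain h | h | h : Fintype.card ι = 1 ∨ Fintype.card ι = 2 ∨ 3 ≤ Fintype.card ι := by omega
  · simpa [h] using varentropy_le_log_two_sq_mul hp
  · simpa [h, show (2 : ℝ) - 1 = 1 by norm_num] using varentropy_le_log_two_sq_mul hp
  · exact varentropy_le_log_card_sq_of_three_le h hp

theorem concaveOn_exp_mul_shannonEntropy {c : ℝ} (hc : 0 ≤ c)
    (h : c * log (Fintype.card ι) ^ 2 ≤ 1) :
    ConcaveOn ℝ (stdSimplex ℝ ι) fun p => exp (c * shannonEntropy p) :=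
  concaveOn_comp_mul_shannonEntropy hc continuous_exp.continuousOn
    (fun y _ => hasDerivAt_exp y) (fun y _ => hasDerivAt_exp y) (fun y _ => (exp_pos y).le)
    fun _ hp _ => mul_le_of_le_one_right (exp_pos _).le
      ((mul_le_mul_of_nonneg_left (varentropy_le_log_card_sq hp) hc).trans h)

end LogCardBound

section PhotonNumber

open Real

/-- The derivative of `photonG` on the positive reals. -/
noncomputable def photonGDeriv (x : ℝ) : ℝ :=
  log (x + 1) - log x

/-- The variance of the logarithm of the geometric distribution of mean `x`, which has entropy
`photonG x`; the counterpart of `varentropy` for the photon number. -/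
noncomputable def photonVariance (x : ℝ) : ℝ :=
  x * (x + 1) * photonGDeriv x ^ 2

/-- The derivative of `photonVariance` with respect to `photonG`, used as the slope of the tangents
to the curve `(photonG x, photonVariance x)`. -/
noncomputable def photonSlope (x : ℝ) : ℝ :=
  (2 * x + 1) * photonGDeriv x - 2

theorem continuous_photonG : Continuous photonG :=
  (continuous_mul_log.comp (continuous_add_const 1)).sub continuous_mul_log

theorem photonG_zero : photonG 0 = 0 := by simp [photonG]

variable {x y z : ℝ}

theorem photonGDeriv_pos (hx : 0 < x) : 0 < photonGDeriv x :=
  sub_pos.2 (log_lt_log hx (lt_add_one x))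

theorem photonGDeriv_eq_log_div (hx : 0 < x) : photonGDeriv x = log ((x + 1) / x) :=
  (log_div (by positivity) hx.ne').symm

theorem photonVariance_nonneg (hx : 0 ≤ x) : 0 ≤ photonVariance x := by
  rw [photonVariance]
  positivity

theorem photonVariance_pos (hx : 0 < x) : 0 < photonVariance x := by
  have := photonGDeriv_pos hx
  rw [photonVariance]
  positivity

theorem hasDerivAt_photonG (hx : 0 < x) : HasDerivAt photonG (photonGDeriv x) x :=
  (((hasDerivAt_mul_log (by positivity : x + 1 ≠ 0)).comp_add_const x 1).sub
    (hasDerivAt_mul_log hx.ne')).congr_deriv (by rw [photonGDeriv]; ring)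

theorem hasDerivAt_photonGDeriv (hx : 0 < x) :
    HasDerivAt photonGDeriv (-(x * (x + 1))⁻¹) x := by
  refine (((hasDerivAt_log (by positivity : x + 1 ≠ 0)).comp_add_const x 1).sub
    (hasDerivAt_log hx.ne')).congr_deriv ?_
  field_simp
  ring

theorem hasDerivAt_photonSlope (hx : 0 < x) :
    HasDerivAt photonSlope (2 * photonGDeriv x - (2 * x + 1) / (x * (x + 1))) x :=
  ((((hasDerivAt_const_mul 2).add_const 1).mul (hasDerivAt_photonGDeriv hx)).sub_const
    2).congr_deriv (by ring)

theorem hasDerivAt_photonVariance (hx : 0 < x) :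
    HasDerivAt photonVariance (photonGDeriv x * photonSlope x) x := by
  have hmul : HasDerivAt (fun z : ℝ => z * (z + 1)) (2 * x + 1) x :=
    ((hasDerivAt_id' x).fun_mul ((hasDerivAt_id' x).add_const 1)).congr_deriv (by ring)
  refine (hmul.fun_mul ((hasDerivAt_photonGDeriv hx).fun_pow 2)).congr_deriv ?_
  rw [photonSlope]
  field_simp
  simp only [Nat.cast_ofNat, Nat.add_one_sub_one, pow_one]
  ring

theorem strictMonoOn_photonG : StrictMonoOn photonG (Set.Ici 0) := by
  refine strictMonoOn_of_hasDerivWithinAt_pos (f' := photonGDeriv) (convex_Ici 0)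
    continuous_photonG.continuousOn ?_ ?_
  all_goals rw [interior_Ici]
  · exact fun x hx => (hasDerivAt_photonG hx).hasDerivWithinAt
  · exact fun x hx => photonGDeriv_pos hx

theorem log_le_sub_inv_div_two (hy : 1 ≤ y) : log y ≤ (y - y⁻¹) / 2 := by
  rw [← sinh_log (by linarith)]
  exact self_le_sinh_iff.2 (log_nonneg hy)

theorem two_mul_div_le_neg_log (hx : 0 < x) (hx1 : x ≤ 1) :
    2 * (1 - x) / (1 + x) ≤ -log x := by
  have h := le_log_one_add_of_nonneg (x := x⁻¹ - 1) (sub_nonneg.2 ((one_le_inv₀ hx).2 hx1))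
  have hden : x⁻¹ - 1 + 2 = (1 + x) / x := by
    field_simp
    ring
  rw [add_sub_cancel, log_inv, hden] at h
  refine le_of_eq_of_le ?_ h
  field_simp

theorem photonGDeriv_le (hx : 0 < x) : photonGDeriv x ≤ (2 * x + 1) / (2 * (x * (x + 1))) := by
  rw [photonGDeriv_eq_log_div hx]
  refine (log_le_sub_inv_div_two ((one_le_div hx).2 (by linarith))).trans_eq ?_
  field_simp
  ring

theorem le_photonGDeriv (hx : 0 < x) : 2 / (2 * x + 1) ≤ photonGDeriv x := by
  have h := le_log_one_add_of_nonneg (inv_nonneg.2 hx.le)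
  rw [photonGDeriv_eq_log_div hx, add_div, div_self hx.ne', one_div]
  refine le_of_eq_of_le ?_ h
  field_simp
  ring

theorem photonSlope_nonneg (hx : 0 < x) : 0 ≤ photonSlope x := by
  have h := (div_le_iff₀' (by positivity)).1 (le_photonGDeriv hx)
  exact sub_nonneg.2 h

theorem antitoneOn_photonSlope : AntitoneOn photonSlope (Set.Ioi 0) := by
  refine antitoneOn_of_hasDerivWithinAt_nonpos
    (f' := fun x => 2 * photonGDeriv x - (2 * x + 1) / (x * (x + 1))) (convex_Ioi 0)
    (fun x hx => (hasDerivAt_photonSlope hx).continuousAt.continuousWithinAt) ?_ ?_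
  all_goals rw [interior_Ioi]
  · exact fun x hx => (hasDerivAt_photonSlope hx).hasDerivWithinAt
  · intro x hx
    have h := photonGDeriv_le hx
    rw [mul_comm 2 (_ * _), ← div_div, le_div_iff₀' two_pos] at h
    exact sub_nonpos.2 h

theorem exists_photonVariance_sub_eq (hx : 0 < x) (hxy : x < y) :
    ∃ z ∈ Set.Ioo x y,
      photonVariance y - photonVariance x = photonSlope z * (photonG y - photonG x) := by
  have hpos {z : ℝ} (hz : z ∈ Set.Icc x y) : 0 < z := hx.trans_le hz.1
  obtain ⟨z, hz, h⟩ := exists_ratio_hasDerivAt_eq_ratio_slope photonVariance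
    (fun z => photonGDeriv z * photonSlope z) hxy
    (fun z hz => (hasDerivAt_photonVariance (hpos hz)).continuousAt.continuousWithinAt)
    (fun z hz => hasDerivAt_photonVariance (hpos (Set.Ioo_subset_Icc_self hz))) photonG
    photonGDeriv continuous_photonG.continuousOn
    (fun z hz => hasDerivAt_photonG (hpos (Set.Ioo_subset_Icc_self hz)))
  refine ⟨z, hz, mul_right_cancel₀ (photonGDeriv_pos (hx.trans hz.1)).ne' ?_⟩
  linarith

theorem photonVariance_le_tangent (hx : 0 < x) (hy : 0 < y) :
    photonVariance x ≤ photonVariance y + photonSlope y * (photonG x - photonG y) := by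
  rcases lt_trichotomy x y with hxy | rfl | hxy
  · obtain ⟨z, hz, h⟩ := exists_photonVariance_sub_eq hx hxy
    have hslope := antitoneOn_photonSlope (hx.trans hz.1) hy hz.2.le
    have hG := strictMonoOn_photonG hx.le hy.le hxy
    linarith [mul_le_mul_of_nonneg_right hslope (sub_nonneg.2 hG.le)]
  · simp
  · obtain ⟨z, hz, h⟩ := exists_photonVariance_sub_eq hy hxy
    have hslope := antitoneOn_photonSlope hy (hy.trans hz.1) hz.1.le
    have hG := strictMonoOn_photonG hy.le hx.le hxy
    linarith [mul_le_mul_of_nonneg_right hslope (sub_nonneg.2 hG.le)]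

theorem photonSlope_mul_photonG_le (hy : 0 < y) :
    photonSlope y * photonG y ≤ photonVariance y := by
  have hlim : Filter.Tendsto
      (fun x => photonVariance y + photonSlope y * (photonG x - photonG y))
      (nhdsWithin 0 (Set.Ioi 0))
      (nhds (photonVariance y + photonSlope y * (photonG 0 - photonG y))) :=
    (Continuous.tendsto (by have := continuous_photonG; fun_prop) 0).mono_left nhdsWithin_le_nhds
  have hnonneg := ge_of_tendsto hlim (b := 0) (by
    filter_upwards [self_mem_nhdsWithin] with x hx
    exact (photonVariance_nonneg (le_of_lt hx)).trans (photonVariance_le_tangent hx hy))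
  rw [photonG_zero] at hnonneg
  linarith

theorem add_one_mul_log_add_one_le (hx : 0 ≤ x) : (x + 1) * log (x + 1) ≤ x + x ^ 2 / 2 := by
  calc
    (x + 1) * log (x + 1) ≤ (x + 1) * ((x + 1 - (x + 1)⁻¹) / 2) := by
      gcongr
      exact log_le_sub_inv_div_two (by linarith)
    _ = x + x ^ 2 / 2 := by field_simp; ring

theorem mul_one_sub_add_sq_div_two_le {p : ℝ} (hp : p ∈ Set.Ioo (0 : ℝ) 1) :
    p * (1 - p) + (p * (1 - p)) ^ 2 / 2 ≤ p ^ 2 * -log p + (1 - p) ^ 2 * -log (1 - p) := by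
  have hq : 0 < 1 - p := sub_pos.2 hp.2
  have hw : 0 < p * (1 - p) := mul_pos hp.1 hq
  have hw1 : p * (1 - p) ≤ 1 := mul_le_one₀ hp.2.le hq.le (by linarith [hp.1])
  calc
    p * (1 - p) + (p * (1 - p)) ^ 2 / 2 ≤
        2 * (p * (1 - p)) * (1 + 2 * (p * (1 - p))) / (2 + p * (1 - p)) := by
      rw [le_div_iff₀ (by positivity)]
      nlinarith [mul_pos hw hw, mul_pos hw (mul_pos hw hw)]
    _ = p ^ 2 * (2 * (1 - p) / (1 + p)) +
        (1 - p) ^ 2 * (2 * (1 - (1 - p)) / (1 + (1 - p))) := by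
      have hp1 : 1 + p ≠ 0 := by linarith [hp.1]
      have hq1 : 1 + (1 - p) ≠ 0 := by linarith
      have hw2 : 2 + p * (1 - p) ≠ 0 := by positivity
      field_simp
      ring
    _ ≤ p ^ 2 * -log p + (1 - p) ^ 2 * -log (1 - p) := by
      gcongr
      · exact two_mul_div_le_neg_log hp.1 hp.2.le
      · exact two_mul_div_le_neg_log hq (by linarith [hp.1])

theorem photonG_mul_one_sub_le_binEntropy {p : ℝ} (hp : p ∈ Set.Ioo (0 : ℝ) 1) :
    photonG (p * (1 - p)) ≤ binEntropy p := by
  have hq : 0 < 1 - p := sub_pos.2 hp.2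
  have hG := add_one_mul_log_add_one_le (mul_pos hp.1 hq).le
  have hlog := mul_one_sub_add_sq_div_two_le hp
  rw [photonG, log_mul hp.1.ne' hq.ne', binEntropy, log_inv, log_inv]
  linarith

theorem mul_one_sub_mul_log_sub_log_sq_le_photonVariance {p : ℝ} (hp : p ∈ Set.Ioo (0 : ℝ) 1) :
    p * (1 - p) * (log p - log (1 - p)) ^ 2 ≤ photonVariance (p * (1 - p)) := by
  have hq : 0 < 1 - p := sub_pos.2 hp.2
  have hw : 0 < p * (1 - p) := mul_pos hp.1 hq
  have hlogw := log_nonneg (by linarith : 1 ≤ p * (1 - p) + 1)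
  have hlogp := log_nonpos hp.1.le hp.2.le
  have hlogq := log_nonpos hq.le (by linarith [hp.1])
  have hsq : (log p - log (1 - p)) ^ 2 ≤ photonGDeriv (p * (1 - p)) ^ 2 := by
    rw [photonGDeriv, log_mul hp.1.ne' hq.ne']
    exact sq_le_sq' (by linarith) (by linarith)
  rw [photonVariance]
  exact mul_le_mul (le_mul_of_one_le_right hw.le (by linarith)) hsq (sq_nonneg _) (by positivity)

theorem mul_one_sub_mul_log_sub_log_sq_le_tangent (hz : 0 < z) {p : ℝ}
    (hp : p ∈ Set.Ioo (0 : ℝ) 1) :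
    p * (1 - p) * (log p - log (1 - p)) ^ 2 ≤
      (photonVariance z - photonSlope z * photonG z) + photonSlope z * binEntropy p := by
  have hw : 0 < p * (1 - p) := mul_pos hp.1 (sub_pos.2 hp.2)
  calc
    p * (1 - p) * (log p - log (1 - p)) ^ 2 ≤ photonVariance (p * (1 - p)) :=
      mul_one_sub_mul_log_sub_log_sq_le_photonVariance hp
    _ ≤ photonVariance z + photonSlope z * (photonG (p * (1 - p)) - photonG z) :=
      photonVariance_le_tangent hw hz
    _ = (photonVariance z - photonSlope z * photonG z) +
        photonSlope z * photonG (p * (1 - p)) := by ring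
    _ ≤ (photonVariance z - photonSlope z * photonG z) + photonSlope z * binEntropy p := by
      have := photonSlope_nonneg hz
      gcongr
      exact photonG_mul_one_sub_le_binEntropy hp

theorem photonG_photonGInv (hy : 0 ≤ y) : photonG (photonGInv y) = y :=
  photonG_bijOn.surjOn.rightInvOn_invFunOn hy

theorem photonGInv_nonneg (hy : 0 ≤ y) : 0 ≤ photonGInv y :=
  photonG_bijOn.surjOn.mapsTo_invFunOn hy

theorem photonGInv_photonG (hx : 0 ≤ x) : photonGInv (photonG x) = x :=
  photonG_bijOn.injOn.leftInvOn_invFunOn hx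

theorem photonGInv_pos (hy : 0 < y) : 0 < photonGInv y := by
  refine (photonGInv_nonneg hy.le).lt_of_ne fun h => hy.ne ?_
  rw [← photonG_photonGInv hy.le, ← h, photonG_zero]

theorem strictMonoOn_photonGInv : StrictMonoOn photonGInv (Set.Ici 0) := fun a ha b hb hab => by
  rwa [← strictMonoOn_photonG.lt_iff_lt (photonGInv_nonneg ha) (photonGInv_nonneg hb),
    photonG_photonGInv ha, photonG_photonGInv hb]

theorem surjOn_photonGInv : Set.SurjOn photonGInv (Set.Ici 0) (Set.Ici 0) := fun x hx =>
  ⟨photonG x, photonG_bijOn.mapsTo hx, photonGInv_photonG hx⟩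

theorem continuousAt_photonGInv (hy : 0 < y) : ContinuousAt photonGInv y :=
  strictMonoOn_photonGInv.continuousAt_of_image_mem_nhds (Ici_mem_nhds hy)
    (Filter.mem_of_superset (Ici_mem_nhds (photonGInv_pos hy)) surjOn_photonGInv)

theorem continuousOn_photonGInv : ContinuousOn photonGInv (Set.Ici 0) := fun y hy => by
  rcases (Set.mem_Ici.1 hy).eq_or_lt with rfl | hy
  · exact strictMonoOn_photonGInv.continuousWithinAt_right_of_surjOn self_mem_nhdsWithin
      (surjOn_photonGInv.mono subset_rfl fun x hx => (photonGInv_nonneg le_rfl).trans (le_of_lt hx))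
  · exact (continuousAt_photonGInv hy).continuousWithinAt

theorem hasDerivAt_photonGInv (hy : 0 < y) :
    HasDerivAt photonGInv (photonGDeriv (photonGInv y))⁻¹ y := by
  have hN := photonGInv_pos hy
  refine HasDerivAt.of_local_left_inverse (continuousAt_photonGInv hy) (hasDerivAt_photonG hN)
    (photonGDeriv_pos hN).ne' ?_
  filter_upwards [Ici_mem_nhds hy] with z hz using photonG_photonGInv hz

theorem hasDerivAt_inv_photonGDeriv_photonGInv (hy : 0 < y) :
    HasDerivAt (fun y => (photonGDeriv (photonGInv y))⁻¹)
      (photonVariance (photonGInv y) * photonGDeriv (photonGInv y))⁻¹ y := by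
  have hN := photonGInv_pos hy
  have hD := photonGDeriv_pos hN
  have hcomp : HasDerivAt (fun y => photonGDeriv (photonGInv y)) _ y :=
    (hasDerivAt_photonGDeriv hN).comp y (hasDerivAt_photonGInv hy)
  refine (hcomp.fun_inv hD.ne').congr_deriv ?_
  rw [photonVariance]
  field_simp

variable {ι : Type*} [Fintype ι] {c : ℝ}

theorem mul_varentropy_le_photonVariance (hc : 0 ≤ c) (h : c * ((Fintype.card ι : ℝ) - 1) ≤ 1)
    {p : ι → ℝ} (hp : p ∈ stdSimplex ℝ ι) (hH : 0 < c * shannonEntropy p) :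
    c * varentropy p ≤ photonVariance (photonGInv (c * shannonEntropy p)) := by
  have hN := photonGInv_pos hH
  have hG := photonG_photonGInv hH.le
  set N := photonGInv (c * shannonEntropy p)
  have hA : 0 ≤ photonVariance N - photonSlope N * photonG N :=
    sub_nonneg.2 (photonSlope_mul_photonG_le hN)
  calc
    c * varentropy p ≤ c * ((photonVariance N - photonSlope N * photonG N) *
        ((Fintype.card ι : ℝ) - 1) + photonSlope N * shannonEntropy p) := by
      gcongr
      exact varentropy_le_of_binary hA (photonSlope_nonneg hN)
        (fun x hx => mul_one_sub_mul_log_sub_log_sq_le_tangent hN hx) hp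
    _ = (photonVariance N - photonSlope N * photonG N) * (c * ((Fintype.card ι : ℝ) - 1)) +
        photonSlope N * photonG N := by rw [hG]; ring
    _ ≤ (photonVariance N - photonSlope N * photonG N) * 1 + photonSlope N * photonG N := by
      gcongr
    _ = photonVariance N := by ring

theorem concaveOn_photonGInv_mul_shannonEntropy (hc : 0 ≤ c)
    (h : c * ((Fintype.card ι : ℝ) - 1) ≤ 1) :
    ConcaveOn ℝ (stdSimplex ℝ ι) fun p => photonGInv (c * shannonEntropy p) := by
  refine concaveOn_comp_mul_shannonEntropy hc continuousOn_photonGInv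
    (fun y hy => hasDerivAt_photonGInv hy)
    (fun y hy => hasDerivAt_inv_photonGDeriv_photonGInv hy)
    (fun y hy => (inv_pos.2 (photonGDeriv_pos (photonGInv_pos hy))).le) fun p hp hH => ?_
  have hN := photonGInv_pos hH
  have hD := photonGDeriv_pos hN
  rw [mul_inv, mul_right_comm]
  exact mul_le_of_le_one_left (inv_pos.2 hD).le
    (inv_mul_le_one_of_le₀ (mul_varentropy_le_photonVariance hc h hp hH)
      (photonVariance_pos hN).le)

end PhotonNumber

/-- The bounds `c ≤ 1 / (log d)²` and `c ≤ 1 / (d - 1)` are written without division, so that they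
read `c < ∞` when `d = 1`. -/
theorem theorem2 (d : ℕ) (c : ℝ) (hc : 0 ≤ c) :
    (c * Real.log d ^ 2 ≤ 1 → ConcaveOn ℝ (qState d) (entropyPower c)) ∧
    (c * ((d : ℝ) - 1) ≤ 1 → ConcaveOn ℝ (qState d) (entropyPhotonNumber c)) := by
  refine ⟨fun h => ?_, fun h => ?_⟩
  · refine concaveOn_comp_vonNeumannEntropy (f := fun y => Real.exp (c * y)) ?_ ?_
    · exact fun a _ b _ hab => Real.exp_le_exp.2 (mul_le_mul_of_nonneg_left hab hc)
    · exact concaveOn_exp_mul_shannonEntropy hc (by rwa [Fintype.card_fin])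
  · refine concaveOn_comp_vonNeumannEntropy (f := fun y => photonGInv (c * y)) ?_ ?_
    · exact fun a ha b hb hab => strictMonoOn_photonGInv.monotoneOn (mul_nonneg hc ha)
        (mul_nonneg hc hb) (mul_le_mul_of_nonneg_left hab hc)
    · exact concaveOn_photonGInv_mul_shannonEntropy hc (by rwa [Fintype.card_fin])
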